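/- Let $\Gamma$ be a group generated by a finite set $S$, with neutral element $e$; let $|x|$ be the word length of $x$ with respect to $S\cup S^{-1}$ and $S_n=\{x\in\Gamma : |x|=n\}$. Let $\mu$ be an admissible probability measure on $\Gamma$, that is, the support of $\mu$ generates $\Gamma$ as a semigroup ($\mu$ need be neither symmetric nor finitely supported). Let $p_k(x,y)$ be the $k$-step transition probabilities of the random walk on $\Gamma$ with step distribution $\mu$, and set $$G(x,y)=\sum_{k\ge 0}p_k(x,y),\qquad H_1(n)=\sum_{x\in S_n}G(e,x),\qquad \omega_\Gamma(1)=\limsup_{n\to\infty}\frac1n\log H_1(n).$$ 1. If the random walk is transient, i.e. $G(e,e)<\infty$, then $\omega_\Gamma(1)=0$. 2. If $\Gamma$ has exponential growth, i.e. $\limsup_{n\to\infty}\frac1n\log \sharp S_n>0$, then there is a constant $C>0$ (depending on $\Gamma$, $S$ and $\mu$) such that $H_1(n)\le Cn^3$ for all $n\ge 1$. -/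

import Mathlib

open scoped ENNReal NNReal

noncomputable section

namespace GreenGrowth

variable {Γ : Type*} [Group Γ]

/-- The word length `|x|` of `x` with respect to a generating set `S`: the least length of a word
in the letters `s` and `s⁻¹`, `s ∈ S`, whose product is `x`. -/
def wordLength (S : Set Γ) (x : Γ) : ℕ :=
  sInf {k : ℕ | ∃ l : List Γ, (∀ g ∈ l, g ∈ S ∨ g⁻¹ ∈ S) ∧ l.prod = x ∧ l.length = k}

/-- The sphere `S_n` of radius `n` centred at the neutral element. -/
def sphere (S : Set Γ) (n : ℕ) : Set Γ :=
  {x | wordLength S x = n}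

/-- The exponential growth rate `limsup (1/n) log a_n` of a sequence in `[0, ∞]`, with values in the
extended reals (so `log 0 = -∞` and `log ∞ = ∞`). -/
def growthRate (a : ℕ → ℝ≥0∞) : EReal :=
  Filter.limsup (fun n : ℕ => ENNReal.log (a n) / (n : EReal)) Filter.atTop

/-- The volume growth `v = limsup (1/n) log #S_n` with respect to `S`. -/
def volumeGrowth (S : Set Γ) : EReal :=
  growthRate fun n => ((sphere S n).encard : ℝ≥0∞)

/-- Exponential growth: `v > 0`. -/
def HasExponentialGrowth (S : Set Γ) : Prop :=
  0 < volumeGrowth S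

/-- A probability measure on `Γ` is admissible if its support generates `Γ` as a semigroup. -/
def IsAdmissible (μ : PMF Γ) : Prop :=
  Subsemigroup.closure μ.support = ⊤

/-- The law of the position at time `n` of the random walk on `Γ` started at `x`, whose steps
`z ↦ z * g` are independent with `g` distributed according to `μ`. -/
def walkLaw (μ : PMF Γ) (x : Γ) : ℕ → PMF Γ
  | 0 => PMF.pure x
  | n + 1 => (walkLaw μ x n).bind fun z => μ.map fun g => z * g

/-- The `n`-step transition probability `p_n(x, y)`. -/
def transitionProb (μ : PMF Γ) (n : ℕ) (x y : Γ) : ℝ≥0∞ :=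
  walkLaw μ x n y

/-- The Green function `G(x, y | r) = ∑_n r ^ n p_n(x, y)`, with values in `[0, ∞]`. -/
def green (μ : PMF Γ) (r : ℝ≥0) (x y : Γ) : ℝ≥0∞ :=
  ∑' n : ℕ, (r : ℝ≥0∞) ^ n * transitionProb μ n x y

/-- The random walk is transient: `G(e, e | 1) < ∞`. -/
def IsTransient (μ : PMF Γ) : Prop :=
  green μ 1 1 1 < ∞

/-- The growth function `H_r(n) = ∑_{x ∈ S_n} G(e, x | r)` of the Green function. -/
def greenSphere (S : Set Γ) (μ : PMF Γ) (r : ℝ≥0) (n : ℕ) : ℝ≥0∞ :=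
  ∑' x : sphere S n, green μ r 1 (x : Γ)

/-- The growth rate `ω_Γ(r) = limsup (1/n) log H_r(n)` of the Green function. -/
def omega (S : Set Γ) (μ : PMF Γ) (r : ℝ≥0) : EReal :=
  growthRate (greenSphere S μ r)

end GreenGrowth

end

namespace GreenGrowth

open scoped Pointwise
open Filter

variable {Γ : Type*} [Group Γ]

/-! The cubic bound rests on the decay `exp (-c * k ^ (1/3))` of the `k`-step densities under
exponential growth. It is proved for the lazy walk, where one step lowers the squared `ℓ²` norm by
at least a quarter of the Dirichlet form, without any symmetry of `μ`
(`sqNorm_lazyStep_add_dirichletForm_le`). Averaging translation energies over a ball of radius `r`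
gives a Nash inequality `‖f‖² ≤ C r² E(f)` once the ball has at least `2 / ‖f‖²` elements
(`exists_nash`). Exponential growth allows `r` of order `log (2 / ‖f‖²)`, and the resulting
difference inequality makes the cube of this logarithm grow linearly in `k`
(`exists_le_log_cube_of_nash`). When the lazy Green function is summed over a ball of radius `n`,
times up to order `n³` contribute at most 1 each, later times a bounded total. The lazy Green
function dominates the original one (`green_le_tsum_lazyLaw`).

For the growth rate, `∑ H_1(n)` is the total time spent in the group, hence infinite, which excludes
a negative rate. The upper bound is the cubic one under exponential growth; otherwise `G(e,x) ≤
G(e,e)` and the spheres are subexponential. -/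

/-! ### The walk and its lazy version -/

theorem walkLaw_succ_apply (μ : PMF Γ) (x : Γ) (n : ℕ) (y : Γ) :
    walkLaw μ x (n + 1) y = ∑' g, μ g * walkLaw μ x n (y * g⁻¹) := by
  have h : ∀ z, (μ.map fun g => z * g) y = μ (z⁻¹ * y) := by
    intro z
    rw [PMF.map_apply, tsum_eq_single (z⁻¹ * y)]
    · simp
    · intro b hb
      rw [if_neg]
      rintro rfl
      simp at hb
  simp only [walkLaw, PMF.bind_apply, h]
  rw [← ((Equiv.inv Γ).trans (Equiv.mulLeft y)).tsum_eq]
  simp [mul_comm]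

/-- The Markov operator of the walk, acting on densities. -/
noncomputable def markov (μ : PMF Γ) (f : Γ → ℝ≥0∞) (x : Γ) : ℝ≥0∞ :=
  ∑' g, μ g * f (x * g⁻¹)

open Classical in
/-- The densities of the lazy walk, which stays where it is with probability one half. -/
noncomputable def lazyLaw (μ : PMF Γ) : ℕ → Γ → ℝ≥0∞
  | 0 => fun x => if x = 1 then 1 else 0
  | k + 1 => fun x => 2⁻¹ * lazyLaw μ k x + 2⁻¹ * markov μ (lazyLaw μ k) x

theorem tsum_mul_right_eq (f : Γ → ℝ≥0∞) (g : Γ) : ∑' x, f (x * g) = ∑' x, f x :=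
  (Equiv.mulRight g).tsum_eq f

theorem tsum_markov (μ : PMF Γ) (f : Γ → ℝ≥0∞) : ∑' x, markov μ f x = ∑' x, f x := by
  simp only [markov]
  rw [ENNReal.tsum_comm]
  simp_rw [ENNReal.tsum_mul_left, tsum_mul_right_eq, ENNReal.tsum_mul_right, μ.tsum_coe, one_mul]

theorem half_mul_add_half_mul (a : ℝ≥0∞) : 2⁻¹ * a + 2⁻¹ * a = a := by
  rw [← add_mul, ENNReal.inv_two_add_inv_two, one_mul]

theorem tsum_lazyLaw (μ : PMF Γ) (k : ℕ) : ∑' x, lazyLaw μ k x = 1 := by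
  induction k with
  | zero => simp [lazyLaw]
  | succ k ih =>
    simp only [lazyLaw]
    rw [ENNReal.tsum_add, ENNReal.tsum_mul_left, ENNReal.tsum_mul_left, tsum_markov, ih,
      half_mul_add_half_mul]

theorem lazyLaw_le_one (μ : PMF Γ) (k : ℕ) (x : Γ) : lazyLaw μ k x ≤ 1 :=
  (ENNReal.le_tsum x).trans_eq (tsum_lazyLaw μ k)

theorem lazyLaw_ne_top (μ : PMF Γ) (k : ℕ) (x : Γ) : lazyLaw μ k x ≠ ∞ :=
  ((lazyLaw_le_one μ k x).trans_lt ENNReal.one_lt_top).ne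

theorem markov_mono (μ : PMF Γ) {f f' : Γ → ℝ≥0∞} (h : ∀ x, f x ≤ f' x) (x : Γ) :
    markov μ f x ≤ markov μ f' x :=
  ENNReal.tsum_le_tsum fun _ => mul_le_mul_right (h _) _

theorem markov_le_of_le (μ : PMF Γ) {f : Γ → ℝ≥0∞} {c : ℝ≥0∞} (h : ∀ x, f x ≤ c) (x : Γ) :
    markov μ f x ≤ c :=
  calc markov μ f x ≤ ∑' g, μ g * c := ENNReal.tsum_le_tsum fun _ => mul_le_mul_right (h _) _
    _ = c := by rw [ENNReal.tsum_mul_right, μ.tsum_coe, one_mul]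

theorem markov_const_mul (μ : PMF Γ) (c : ℝ≥0∞) (f : Γ → ℝ≥0∞) (x : Γ) :
    markov μ (fun y => c * f y) x = c * markov μ f x := by
  simp only [markov, ← ENNReal.tsum_mul_left]
  exact tsum_congr fun g => by ring

theorem markov_tsum (μ : PMF Γ) {ι : Type*} (f : ι → Γ → ℝ≥0∞) (x : Γ) :
    markov μ (fun y => ∑' i, f i y) x = ∑' i, markov μ (f i) x := by
  simp only [markov, ← ENNReal.tsum_mul_left]
  exact ENNReal.tsum_comm

/-- Chapman–Kolmogorov: `markov` uses right translations only, so it commutes with left translation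
by `y⁻¹`. -/
theorem lazyLaw_add (μ : PMF Γ) (j k : ℕ) (x : Γ) :
    lazyLaw μ (j + k) x = ∑' y, lazyLaw μ j y * lazyLaw μ k (y⁻¹ * x) := by
  classical
  induction k generalizing x with
  | zero =>
    rw [tsum_eq_single x]
    · simp [lazyLaw]
    · intro b hb
      have : b⁻¹ * x ≠ 1 := fun h => hb (inv_mul_eq_one.1 h)
      simp [lazyLaw, this]
  | succ k ih =>
    rw [← add_assoc]
    simp only [lazyLaw]
    rw [funext ih, markov_tsum]
    simp_rw [markov_const_mul μ]
    rw [← ENNReal.tsum_mul_left, ← ENNReal.tsum_mul_left, ← ENNReal.tsum_add]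
    refine tsum_congr fun y => ?_
    have : markov μ (fun x => lazyLaw μ k (y⁻¹ * x)) x = markov μ (lazyLaw μ k) (y⁻¹ * x) := by
      simp [markov, mul_assoc]
    rw [this]
    ring

/-! ### Sup norm against `ℓ²` norm -/

/-- The squared `ℓ²` norm. -/
noncomputable def sqNorm (f : Γ → ℝ≥0∞) : ℝ≥0∞ := ∑' x, f x ^ 2

theorem two_mul_mul_le_sq_add_sq (a b : ℝ≥0∞) : 2 * (a * b) ≤ a ^ 2 + b ^ 2 := by
  by_cases ha : a = ∞
  · simp [ha]
  by_cases hb : b = ∞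
  · simp [hb]
  lift a to ℝ≥0 using ha
  lift b to ℝ≥0 using hb
  have := two_mul_le_add_sq a b
  rw [mul_assoc] at this
  exact_mod_cast this

/-- The map `y ↦ y⁻¹ * x` preserves counting measure, so Cauchy–Schwarz suffices and no symmetry is
needed. -/
theorem lazyLaw_add_self_le (μ : PMF Γ) (k : ℕ) (x : Γ) :
    lazyLaw μ (k + k) x ≤ sqNorm (lazyLaw μ k) := by
  rw [lazyLaw_add, ← ENNReal.mul_le_mul_iff_right two_ne_zero ENNReal.ofNat_ne_top,
    ← ENNReal.tsum_mul_left]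
  calc ∑' y, 2 * (lazyLaw μ k y * lazyLaw μ k (y⁻¹ * x))
      ≤ ∑' y, (lazyLaw μ k y ^ 2 + lazyLaw μ k (y⁻¹ * x) ^ 2) :=
        ENNReal.tsum_le_tsum fun y => two_mul_mul_le_sq_add_sq _ _
    _ = sqNorm (lazyLaw μ k) + sqNorm (lazyLaw μ k) := by
        rw [ENNReal.tsum_add]
        congr 1
        exact ((Equiv.inv Γ).trans (Equiv.mulRight x)).tsum_eq fun y => lazyLaw μ k y ^ 2
    _ = 2 * sqNorm (lazyLaw μ k) := (two_mul _).symm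

theorem lazyLaw_succ_le_of_le (μ : PMF Γ) {k : ℕ} {c : ℝ≥0∞} (h : ∀ x, lazyLaw μ k x ≤ c)
    (x : Γ) : lazyLaw μ (k + 1) x ≤ c := by
  rw [← half_mul_add_half_mul c]
  exact add_le_add (mul_le_mul_right (h x) _) (mul_le_mul_right (markov_le_of_le μ h x) _)

theorem lazyLaw_le_sqNorm_half (μ : PMF Γ) (k : ℕ) (x : Γ) :
    lazyLaw μ k x ≤ sqNorm (lazyLaw μ (k / 2)) := by
  rcases Nat.even_or_odd' k with ⟨j, rfl | rfl⟩
  · rw [show 2 * j / 2 = j by lia, two_mul]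
    exact lazyLaw_add_self_le μ j x
  · rw [show (2 * j + 1) / 2 = j by lia, two_mul]
    exact lazyLaw_succ_le_of_le μ (lazyLaw_add_self_le μ j) x

/-! ### Dirichlet form and energy dissipation -/

/-- The squared `ℓ²` distance of `f` from its right translate by `g`. -/
noncomputable def shiftEnergy (f : Γ → ℝ≥0) (g : Γ) : ℝ≥0∞ :=
  ∑' x, ((nndist (f x) (f (x * g)) : ℝ≥0) : ℝ≥0∞) ^ 2

/-- The correlation of `f` with its right translate by `g`. -/
noncomputable def shiftCorr (f : Γ → ℝ≥0∞) (g : Γ) : ℝ≥0∞ := ∑' x, f x * f (x * g)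

/-- The Dirichlet form of the walk. -/
noncomputable def dirichletForm (μ : PMF Γ) (f : Γ → ℝ≥0) : ℝ≥0∞ :=
  ∑' g, μ g * shiftEnergy f g

theorem nndist_sq_add_two_mul (a b : ℝ≥0) : nndist a b ^ 2 + 2 * (a * b) = a ^ 2 + b ^ 2 := by
  apply NNReal.coe_injective
  push_cast
  rw [NNReal.dist_eq, sq_abs]
  ring

theorem shiftEnergy_add_corr (f : Γ → ℝ≥0) (g : Γ) :
    shiftEnergy f g + 2 * shiftCorr (fun x => f x) g = 2 * sqNorm (fun x => (f x : ℝ≥0∞)) := by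
  have : sqNorm (fun x => (f x : ℝ≥0∞)) = ∑' x, (f (x * g) : ℝ≥0∞) ^ 2 :=
    (tsum_mul_right_eq (fun x => (f x : ℝ≥0∞) ^ 2) g).symm
  rw [two_mul (sqNorm _)]
  nth_rw 2 [this]
  rw [shiftEnergy, shiftCorr, sqNorm, ← ENNReal.tsum_mul_left, ← ENNReal.tsum_add,
    ← ENNReal.tsum_add]
  exact tsum_congr fun x => mod_cast nndist_sq_add_two_mul (f x) (f (x * g))

theorem tsum_mul_markov (μ : PMF Γ) (f : Γ → ℝ≥0∞) :
    ∑' x, f x * markov μ f x = ∑' g, μ g * shiftCorr f g := by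
  simp only [markov, ← ENNReal.tsum_mul_left]
  rw [ENNReal.tsum_comm]
  refine tsum_congr fun g => ?_
  rw [shiftCorr, ← tsum_mul_right_eq _ g, ← ENNReal.tsum_mul_left]
  refine tsum_congr fun x => ?_
  rw [mul_inv_cancel_right]
  ring

/-- Pointwise Jensen inequality, summed using that `markov` preserves total mass. -/
theorem sqNorm_markov_le (μ : PMF Γ) (f : Γ → ℝ≥0∞) : sqNorm (markov μ f) ≤ sqNorm f := by
  have key : ∀ x, markov μ f x ^ 2 ≤ markov μ (fun y => f y ^ 2) x := by
    intro x
    have h1 : 2 * markov μ f x ^ 2 =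
        ∑' g, ∑' h, μ g * μ h * (2 * (f (x * g⁻¹) * f (x * h⁻¹))) := by
      rw [pow_two, markov, ← ENNReal.tsum_mul_right, ← ENNReal.tsum_mul_left]
      refine tsum_congr fun g => ?_
      rw [← ENNReal.tsum_mul_left, ← ENNReal.tsum_mul_left]
      exact tsum_congr fun h => by ring
    have h2 : ∑' g, ∑' h, μ g * μ h * (f (x * g⁻¹) ^ 2 + f (x * h⁻¹) ^ 2) =
        2 * markov μ (fun y => f y ^ 2) x := by
      simp_rw [mul_add, ENNReal.tsum_add]
      rw [two_mul]
      congr 1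
      · refine tsum_congr fun g => ?_
        rw [ENNReal.tsum_mul_right, ENNReal.tsum_mul_left, μ.tsum_coe, mul_one]
      · simp_rw [mul_assoc, ENNReal.tsum_mul_left, ENNReal.tsum_mul_right, μ.tsum_coe, one_mul]
        rfl
    rw [← ENNReal.mul_le_mul_iff_right two_ne_zero ENNReal.ofNat_ne_top, h1, ← h2]
    exact ENNReal.tsum_le_tsum fun g => ENNReal.tsum_le_tsum fun h =>
      mul_le_mul_right (two_mul_mul_le_sq_add_sq _ _) _
  exact (ENNReal.tsum_le_tsum key).trans_eq (tsum_markov μ _)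

/-- Expand `‖f + Pf‖²`, with `P` the Markov operator: the cross term is `2‖f‖² - E(f)`, and `‖Pf‖ ≤
‖f‖`. -/
theorem sqNorm_lazyStep_add_dirichletForm_le (μ : PMF Γ) (f : Γ → ℝ≥0) :
    4 * sqNorm (fun x => 2⁻¹ * (f x : ℝ≥0∞) + 2⁻¹ * markov μ (fun y => f y) x)
      + dirichletForm μ f ≤ 4 * sqNorm (fun x => (f x : ℝ≥0∞)) := by
  set F : Γ → ℝ≥0∞ := fun x => f x with hF
  have h1 : 4 * sqNorm (fun x => 2⁻¹ * F x + 2⁻¹ * markov μ F x) =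
      sqNorm F + 2 * (∑' x, F x * markov μ F x) + sqNorm (markov μ F) := by
    simp only [sqNorm]
    rw [← ENNReal.tsum_mul_left, ← ENNReal.tsum_mul_left, ← ENNReal.tsum_add, ← ENNReal.tsum_add]
    refine tsum_congr fun x => ?_
    have h4 : (4 : ℝ≥0∞) * (2⁻¹ * 2⁻¹) = 1 := by
      rw [show (4 : ℝ≥0∞) = 2 * 2 by norm_num, mul_mul_mul_comm,
        ENNReal.mul_inv_cancel two_ne_zero ENNReal.ofNat_ne_top, one_mul]
    calc 4 * (2⁻¹ * F x + 2⁻¹ * markov μ F x) ^ 2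
        = 4 * (2⁻¹ * 2⁻¹) * (F x + markov μ F x) ^ 2 := by ring
      _ = _ := by rw [h4]; ring
  have h2 : dirichletForm μ f + 2 * (∑' x, F x * markov μ F x) = 2 * sqNorm F := by
    rw [tsum_mul_markov, dirichletForm, ← ENNReal.tsum_mul_left, ← ENNReal.tsum_add]
    calc _ = ∑' g, μ g * (2 * sqNorm F) := by
          refine tsum_congr fun g => ?_
          rw [← shiftEnergy_add_corr f g]
          ring
      _ = _ := by rw [ENNReal.tsum_mul_right, μ.tsum_coe, one_mul]
  calc 4 * sqNorm (fun x => 2⁻¹ * F x + 2⁻¹ * markov μ F x) + dirichletForm μ f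
      = sqNorm F + (dirichletForm μ f + 2 * (∑' x, F x * markov μ F x)) + sqNorm (markov μ F) := by
        rw [h1]; ring
    _ ≤ sqNorm F + 2 * sqNorm F + sqNorm F := by
        rw [h2]; exact add_le_add_right (sqNorm_markov_le μ F) _
    _ = 4 * sqNorm F := by ring

/-! ### Nash inequality from volume -/

theorem shiftEnergy_mul_le (f : Γ → ℝ≥0) (g h : Γ) {r : ℝ≥0} (hr : r ≠ 0) :
    shiftEnergy f (g * h) ≤
      ((1 + r⁻¹ : ℝ≥0) : ℝ≥0∞) * shiftEnergy f g + ((1 + r : ℝ≥0) : ℝ≥0∞) * shiftEnergy f h := by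
  have h1 : shiftEnergy f h =
      ∑' x, ((nndist (f (x * g)) (f (x * g * h)) : ℝ≥0) : ℝ≥0∞) ^ 2 :=
    (tsum_mul_right_eq (fun x => ((nndist (f x) (f (x * h)) : ℝ≥0) : ℝ≥0∞) ^ 2) g).symm
  rw [h1, shiftEnergy, shiftEnergy, ← ENNReal.tsum_mul_left, ← ENNReal.tsum_mul_left,
    ← ENNReal.tsum_add]
  refine ENNReal.tsum_le_tsum fun x => ?_
  rw [← mul_assoc]
  have h2 := nndist_triangle (f x) (f (x * g)) (f (x * g * h))
  generalize nndist (f x) (f (x * g * h)) = c at *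
  generalize nndist (f x) (f (x * g)) = a at *
  generalize nndist (f (x * g)) (f (x * g * h)) = b at *
  have h3 : c ^ 2 ≤ (1 + r⁻¹) * a ^ 2 + (1 + r) * b ^ 2 := by
    refine (pow_le_pow_left₀ zero_le h2 2).trans ?_
    rw [← NNReal.coe_le_coe]
    push_cast
    have hr' : (0 : ℝ) < r := by exact_mod_cast pos_iff_ne_zero.2 hr
    have : (1 + (r : ℝ)⁻¹) * a ^ 2 + (1 + r) * b ^ 2 - (a + b) ^ 2 = (r : ℝ)⁻¹ * (a - r * b) ^ 2 := by
      field_simp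
      ring
    have h5 : 0 ≤ (r : ℝ)⁻¹ * (a - r * b) ^ 2 := by positivity
    linarith
  exact_mod_cast h3

/-- The weights close the induction exactly: `(1 + 1/r) r² + (1 + r) = (r + 1)²`. -/
theorem shiftEnergy_le_of_mem_pow (f : Γ → ℝ≥0) [DecidableEq Γ] {T : Finset Γ} {M : ℝ≥0∞}
    (hM : ∀ g ∈ T, shiftEnergy f g ≤ M) (r : ℕ) : ∀ g ∈ T ^ r, shiftEnergy f g ≤ (r : ℝ≥0∞) ^ 2 * M := by
  induction r with
  | zero => intro g hg; simp at hg; subst hg; simp [shiftEnergy]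
  | succ r ih =>
    intro g hg
    rw [pow_succ] at hg
    obtain ⟨a, ha, b, hb, rfl⟩ := Finset.mem_mul.1 hg
    rcases Nat.eq_zero_or_pos r with rfl | hr
    · simp at ha; subst ha; simpa using hM b hb
    have hr0 : (r : ℝ≥0) ≠ 0 := by exact_mod_cast hr.ne'
    refine (shiftEnergy_mul_le f a b hr0).trans ?_
    calc _ ≤ ((1 + (r : ℝ≥0)⁻¹ : ℝ≥0) : ℝ≥0∞) * ((r : ℝ≥0∞) ^ 2 * M) + ((1 + r : ℝ≥0) : ℝ≥0∞) * M :=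
          add_le_add (mul_le_mul_right (ih a ha) _) (mul_le_mul_right (hM b hb) _)
      _ = (((1 + (r : ℝ≥0)⁻¹) * r ^ 2 + (1 + r) : ℝ≥0) : ℝ≥0∞) * M := by push_cast; ring
      _ = _ := by
        congr 1
        rw [show (1 + (r : ℝ≥0)⁻¹) * r ^ 2 + (1 + r) = ((r : ℝ≥0) + 1) ^ 2 by field_simp; ring]
        push_cast
        rfl

/-- A point of the support costs `1 / μ x`; products follow from the quasi-triangle inequality.
Semigroup generation makes inverses unnecessary. -/
theorem exists_shiftEnergy_le (μ : PMF Γ) (hμ : IsAdmissible μ) (g : Γ) :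
    ∃ C : ℝ≥0, ∀ f : Γ → ℝ≥0, shiftEnergy f g ≤ C * dirichletForm μ f := by
  have hg : g ∈ Subsemigroup.closure μ.support := by rw [hμ]; trivial
  induction hg using Subsemigroup.closure_induction with
  | mem x hx =>
    have hx0 : μ x ≠ 0 := (μ.mem_support_iff x).1 hx
    refine ⟨(μ x)⁻¹.toNNReal, fun f => ?_⟩
    rw [ENNReal.coe_toNNReal (ENNReal.inv_ne_top.2 hx0)]
    calc shiftEnergy f x = (μ x)⁻¹ * (μ x * shiftEnergy f x) := by
          rw [← mul_assoc, ENNReal.inv_mul_cancel hx0 (μ.apply_ne_top x), one_mul]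
      _ ≤ _ := mul_le_mul_right (ENNReal.le_tsum (f := fun g => μ g * shiftEnergy f g) x) _
  | mul x y _ _ hx hy =>
    obtain ⟨C, hC⟩ := hx
    obtain ⟨C', hC'⟩ := hy
    refine ⟨2 * C + 2 * C', fun f => ?_⟩
    refine (shiftEnergy_mul_le f x y one_ne_zero).trans ?_
    calc _ ≤ ((1 + 1⁻¹ : ℝ≥0) : ℝ≥0∞) * (C * dirichletForm μ f) +
          ((1 + 1 : ℝ≥0) : ℝ≥0∞) * (C' * dirichletForm μ f) :=
        add_le_add (mul_le_mul_right (hC f) _) (mul_le_mul_right (hC' f) _)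
      _ = _ := by
        rw [inv_one, one_add_one_eq_two]
        push_cast
        ring

/-- Sum the polarisation identity over `T ^ r`. The correlations add up to at most `(∑ f)² = 1`, so
the volume hypothesis absorbs them into half of the left side. -/
theorem exists_nash (μ : PMF Γ) (hμ : IsAdmissible μ) [DecidableEq Γ] (T : Finset Γ) :
    ∃ C : ℝ≥0, 0 < C ∧ ∀ f : Γ → ℝ≥0, ∑' x, (f x : ℝ≥0∞) = 1 → ∀ r : ℕ,
      2 ≤ ((T ^ r).card : ℝ≥0∞) * sqNorm (fun x => (f x : ℝ≥0∞)) →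
      sqNorm (fun x => (f x : ℝ≥0∞)) ≤ C * (r : ℝ≥0∞) ^ 2 * dirichletForm μ f := by
  choose c hc using exists_shiftEnergy_le μ hμ
  refine ⟨∑ g ∈ T, c g + 1, by positivity, fun f hf r hr => ?_⟩
  set F : Γ → ℝ≥0∞ := fun x => f x
  set C : ℝ≥0 := ∑ g ∈ T, c g + 1
  set N : ℝ≥0∞ := ((T ^ r).card : ℝ≥0∞)
  have h1 : ∀ g ∈ T, shiftEnergy f g ≤ C * dirichletForm μ f := fun g hg =>
    (hc g f).trans (mul_le_mul_left (ENNReal.coe_le_coe.2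
      ((Finset.single_le_sum (f := c) (fun _ _ => zero_le) hg).trans le_self_add)) _)
  have h2 := shiftEnergy_le_of_mem_pow f h1 r
  have h3 : ∑ g ∈ T ^ r, shiftCorr F g ≤ 1 := by
    calc ∑ g ∈ T ^ r, shiftCorr F g ≤ ∑' g, shiftCorr F g := ENNReal.sum_le_tsum _
      _ = 1 := by
        simp only [shiftCorr]
        rw [ENNReal.tsum_comm]
        simp_rw [ENNReal.tsum_mul_left]
        have : ∀ x : Γ, ∑' g, F (x * g) = 1 := fun x =>
          ((Equiv.mulLeft x).tsum_eq F).trans hf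
        simp_rw [this, mul_one]
        exact hf
  have hu : sqNorm F ≤ 1 := by
    have hle : ∀ x, F x ≤ 1 := fun x => (ENNReal.le_tsum x).trans_eq hf
    rw [← hf]
    refine ENNReal.tsum_le_tsum fun x => ?_
    rw [pow_two]
    exact mul_le_of_le_one_left' (hle x)
  have h4 : N * (2 * sqNorm F) ≤ N * ((r : ℝ≥0∞) ^ 2 * (C * dirichletForm μ f)) + N * sqNorm F := by
    calc N * (2 * sqNorm F) = ∑ g ∈ T ^ r, (shiftEnergy f g + 2 * shiftCorr F g) := by
          simp_rw [F, shiftEnergy_add_corr f]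
          rw [Finset.sum_const, nsmul_eq_mul]
      _ = ∑ g ∈ T ^ r, shiftEnergy f g + 2 * ∑ g ∈ T ^ r, shiftCorr F g := by
          rw [Finset.sum_add_distrib, Finset.mul_sum]
      _ ≤ N * ((r : ℝ≥0∞) ^ 2 * (C * dirichletForm μ f)) + 2 := by
          refine add_le_add ?_ (by simpa using mul_le_mul_right h3 2)
          refine (Finset.sum_le_sum h2).trans ?_
          rw [Finset.sum_const, nsmul_eq_mul]
      _ ≤ _ := add_le_add_right hr _
  have hN : N ≠ 0 := by
    intro h; rw [h] at hr; simp at hr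
  have hNt : N ≠ ∞ := ENNReal.natCast_ne_top _
  have hut : sqNorm F ≠ ∞ := (hu.trans_lt ENNReal.one_lt_top).ne
  rw [← mul_add, ENNReal.mul_le_mul_iff_right hN hNt, two_mul] at h4
  have h5 := (ENNReal.add_le_add_iff_right hut).1 h4
  exact h5.trans_eq (by ring)

/-! ### Decay of the lazy walk -/

/-- With `l = log (2 / u k)`, the choice `r = ⌈l / c⌉` is admissible and of order `l`, so `l` gains
at least `1 / (M l²)` per step and `l³` at least `3 / M`. -/
theorem exists_le_log_cube_of_nash {u : ℕ → ℝ} {c A : ℝ} (hc : 0 < c) (hA : 0 < A)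
    (hpos : ∀ k, 0 < u k) (hle : ∀ k, u k ≤ 1)
    (h : ∀ k r : ℕ, 2 ≤ Real.exp (c * r) * u k → u k ≤ A * r ^ 2 * (u k - u (k + 1))) :
    ∃ a > 0, ∀ k : ℕ, a * k ≤ Real.log (2 / u k) ^ 3 := by
  have hlog2 : 0 < Real.log 2 := Real.log_pos one_lt_two
  -- The summand `1 / log 2` absorbs the rounding of `r`, as `l ≥ log 2`.
  set B : ℝ := 1 / c + 1 / Real.log 2 with hB
  have hBpos : 0 < B := by positivity
  set M : ℝ := A * B ^ 2 with hM
  have hMpos : 0 < M := by positivity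
  have hl : ∀ k, Real.log 2 ≤ Real.log (2 / u k) := fun k =>
    Real.log_le_log two_pos ((le_div_iff₀ (hpos k)).2 (by linarith [hle k]))
  have step : ∀ k, Real.log (2 / u k) + 1 / (M * Real.log (2 / u k) ^ 2)
      ≤ Real.log (2 / u (k + 1)) := by
    intro k
    have hlk := hl k
    have hexp : Real.exp (Real.log (2 / u k)) = 2 / u k := Real.exp_log (div_pos two_pos (hpos k))
    set l := Real.log (2 / u k) with hldef
    have hlpos : 0 < l := hlog2.trans_le hlk
    set r := ⌈l / c⌉₊ with hr
    have hr1 : l ≤ c * r := by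
      have := Nat.le_ceil (l / c)
      rw [div_le_iff₀ hc] at this
      linarith
    have hr2 : (r : ℝ) ≤ B * l := by
      have h1 := (Nat.ceil_lt_add_one (div_nonneg hlpos.le hc.le : 0 ≤ l / c)).le
      have h2 : 1 ≤ 1 / Real.log 2 * l := by
        rw [one_div, inv_mul_eq_div, one_le_div hlog2]
        exact hlk
      calc (r : ℝ) ≤ l / c + 1 := h1
        _ ≤ l / c + 1 / Real.log 2 * l := by linarith
        _ = B * l := by rw [hB]; ring
    have h2 : 2 ≤ Real.exp (c * r) * u k := by
      rw [← div_le_iff₀ (hpos k), ← hexp]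
      exact Real.exp_le_exp.2 hr1
    have h3 := h k r h2
    have hd : 0 < u k - u (k + 1) := by
      by_contra hneg
      push Not at hneg
      have : A * (r : ℝ) ^ 2 * (u k - u (k + 1)) ≤ 0 :=
        mul_nonpos_of_nonneg_of_nonpos (by positivity) hneg
      linarith [hpos k]
    have h4 : u k ≤ M * l ^ 2 * (u k - u (k + 1)) := by
      refine h3.trans (mul_le_mul_of_nonneg_right ?_ hd.le)
      calc A * (r : ℝ) ^ 2 ≤ A * (B * l) ^ 2 := by gcongr
        _ = M * l ^ 2 := by rw [hM]; ring
    have h5 : 1 / (M * l ^ 2) ≤ 1 - u (k + 1) / u k := by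
      rw [div_le_iff₀ (by positivity), ← sub_nonneg]
      have : (1 - u (k + 1) / u k) * (M * l ^ 2) - 1
          = (M * l ^ 2 * (u k - u (k + 1)) - u k) / u k := by
        have := (hpos k).ne'
        field_simp
      rw [this]
      exact div_nonneg (by linarith) (hpos k).le
    have h6 : Real.log (u (k + 1) / u k) ≤ u (k + 1) / u k - 1 :=
      Real.log_le_sub_one_of_pos (div_pos (hpos _) (hpos _))
    rw [Real.log_div (hpos _).ne' (hpos _).ne'] at h6
    rw [Real.log_div two_ne_zero (hpos _).ne']
    have h7 : l = Real.log 2 - Real.log (u k) := Real.log_div two_ne_zero (hpos _).ne'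
    linarith
  refine ⟨3 / M, by positivity, fun k => ?_⟩
  induction k with
  | zero => simpa using pow_nonneg (hlog2.le.trans (hl 0)) 3
  | succ k ih =>
    have hlpos : 0 < Real.log (2 / u k) := hlog2.trans_le (hl k)
    have hs := step k
    set l := Real.log (2 / u k)
    set l' := Real.log (2 / u (k + 1))
    calc 3 / M * ((k + 1 : ℕ) : ℝ) = 3 / M * k + 3 / M := by push_cast; ring
      _ ≤ l ^ 3 + 3 / M := by linarith
      _ ≤ (l + 1 / (M * l ^ 2)) ^ 3 := by
        have h1 : (l + 1 / (M * l ^ 2)) ^ 3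
            = l ^ 3 + 3 / M + 3 * l * (1 / (M * l ^ 2)) ^ 2 + (1 / (M * l ^ 2)) ^ 3 := by
          field_simp
          ring
        rw [h1, add_assoc]
        have : 0 ≤ 3 * l * (1 / (M * l ^ 2)) ^ 2 + (1 / (M * l ^ 2)) ^ 3 := by positivity
        linarith
      _ ≤ l' ^ 3 := by gcongr

theorem lazyLaw_one_pos (μ : PMF Γ) (k : ℕ) : 0 < lazyLaw μ k 1 := by
  induction k with
  | zero => simp [lazyLaw]
  | succ k ih =>
    exact (ENNReal.mul_pos (by simp) ih.ne').trans_le le_self_add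

theorem sqNorm_lazyLaw_pos (μ : PMF Γ) (k : ℕ) : 0 < sqNorm (lazyLaw μ k) :=
  (ENNReal.pow_pos (lazyLaw_one_pos μ k) 2).trans_le (ENNReal.le_tsum (f := fun x => lazyLaw μ k x ^ 2) 1)

theorem sqNorm_lazyLaw_le_one (μ : PMF Γ) (k : ℕ) : sqNorm (lazyLaw μ k) ≤ 1 := by
  rw [← tsum_lazyLaw μ k]
  refine ENNReal.tsum_le_tsum fun x => ?_
  rw [pow_two]
  exact mul_le_of_le_one_left' (lazyLaw_le_one μ k x)

theorem sqNorm_lazyLaw_ne_top (μ : PMF Γ) (k : ℕ) : sqNorm (lazyLaw μ k) ≠ ∞ :=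
  ((sqNorm_lazyLaw_le_one μ k).trans_lt ENNReal.one_lt_top).ne

theorem exists_lazyLaw_decay (μ : PMF Γ) (hμ : IsAdmissible μ) [DecidableEq Γ] {T : Finset Γ}
    {c : ℝ} (hc : 0 < c) (hT : ∀ r : ℕ, Real.exp (c * r) ≤ (T ^ r).card) :
    ∃ a > 0, ∃ l : ℕ → ℝ, ∀ k : ℕ, 2 ≤ k → 0 < l k ∧ a * k ≤ l k ^ 3 ∧
      ∀ x, lazyLaw μ k x ≤ ENNReal.ofReal (2 * Real.exp (-l k)) := by
  obtain ⟨C, hC, hnash⟩ := exists_nash μ hμ T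
  set u : ℕ → ℝ := fun k => (sqNorm (lazyLaw μ k)).toReal with hu
  have hpos : ∀ k, 0 < u k := fun k =>
    ENNReal.toReal_pos (sqNorm_lazyLaw_pos μ k).ne' (sqNorm_lazyLaw_ne_top μ k)
  have hle : ∀ k, u k ≤ 1 := fun k =>
    ENNReal.toReal_le_of_le_ofReal zero_le_one (by simpa using sqNorm_lazyLaw_le_one μ k)
  have hofReal : ∀ k, sqNorm (lazyLaw μ k) = ENNReal.ofReal (u k) := fun k =>
    (ENNReal.ofReal_toReal (sqNorm_lazyLaw_ne_top μ k)).symm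
  have hstep : ∀ k r : ℕ, 2 ≤ Real.exp (c * r) * u k →
      u k ≤ 4 * C * r ^ 2 * (u k - u (k + 1)) := by
    intro k r hr
    set f : Γ → ℝ≥0 := fun x => (lazyLaw μ k x).toNNReal
    have hf : (fun x => (f x : ℝ≥0∞)) = lazyLaw μ k :=
      funext fun x => ENNReal.coe_toNNReal (lazyLaw_ne_top μ k x)
    have h1 := hnash f ((congrArg tsum hf).trans (tsum_lazyLaw μ k)) r
    have h2 := sqNorm_lazyStep_add_dirichletForm_le μ f
    simp only [hf] at h1 h2
    have hsucc : (fun x => 2⁻¹ * (f x : ℝ≥0∞) + 2⁻¹ * markov μ (lazyLaw μ k) x)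
        = lazyLaw μ (k + 1) := by
      funext x
      rw [show (f x : ℝ≥0∞) = lazyLaw μ k x from congrFun hf x]
      rfl
    rw [hsucc] at h2
    have hne : dirichletForm μ f ≠ ∞ := by
      refine ((le_add_self.trans h2).trans_lt ?_).ne
      exact ENNReal.mul_lt_top (by norm_num) (sqNorm_lazyLaw_ne_top μ k).lt_top
    set E := (dirichletForm μ f).toReal with hE
    have hEof : dirichletForm μ f = ENNReal.ofReal E := (ENNReal.ofReal_toReal hne).symm
    have hE0 : 0 ≤ E := ENNReal.toReal_nonneg
    have h3 : E ≤ 4 * (u k - u (k + 1)) := by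
      rw [hofReal, hofReal, hEof, show (4 : ℝ≥0∞) = ENNReal.ofReal 4 by norm_num,
        ← ENNReal.ofReal_mul (by norm_num), ← ENNReal.ofReal_mul (by norm_num),
        ← ENNReal.ofReal_add (by linarith [hpos (k + 1)]) hE0,
        ENNReal.ofReal_le_ofReal_iff (by linarith [hpos k])] at h2
      linarith
    have h4 : 2 ≤ ((T ^ r).card : ℝ≥0∞) * sqNorm (lazyLaw μ k) := by
      rw [hofReal, ← ENNReal.ofReal_natCast, ← ENNReal.ofReal_mul (Nat.cast_nonneg _),
        show (2 : ℝ≥0∞) = ENNReal.ofReal 2 by norm_num]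
      exact ENNReal.ofReal_le_ofReal
        (hr.trans (mul_le_mul_of_nonneg_right (hT r) (hpos k).le))
    have h5 : u k ≤ C * (r : ℝ) ^ 2 * E := by
      have := ENNReal.toReal_mono
        (ENNReal.mul_ne_top (ENNReal.mul_ne_top ENNReal.coe_ne_top (by simp)) hne) (h1 h4)
      simpa using this
    calc u k ≤ C * (r : ℝ) ^ 2 * E := h5
      _ ≤ C * (r : ℝ) ^ 2 * (4 * (u k - u (k + 1))) := by gcongr
      _ = _ := by ring
  have hC' : (0 : ℝ) < 4 * C := by
    have : (0 : ℝ) < C := hC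
    linarith
  obtain ⟨a, ha, hk⟩ := exists_le_log_cube_of_nash hc hC' hpos hle hstep
  -- Time is halved by the sup bound; `k ≤ 3 * (k / 2)` needs `2 ≤ k`.
  refine ⟨a / 3, by positivity, fun k => Real.log (2 / u (k / 2)), fun k hk2 => ⟨?_, ?_, fun x => ?_⟩⟩
  · refine Real.log_pos ((one_lt_div (hpos _)).2 ?_)
    linarith [hle (k / 2)]
  · have h3 : (k : ℝ) ≤ 3 * ((k / 2 : ℕ) : ℝ) := by
      have : k ≤ 3 * (k / 2) := by lia
      exact_mod_cast this
    calc a / 3 * k ≤ a / 3 * (3 * ((k / 2 : ℕ) : ℝ)) := by gcongr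
      _ = a * ((k / 2 : ℕ) : ℝ) := by ring
      _ ≤ _ := hk _
  · rw [Real.exp_neg, Real.exp_log (div_pos two_pos (hpos _))]
    rw [show 2 * (2 / u (k / 2))⁻¹ = u (k / 2) by rw [inv_div]; ring, ← hofReal]
    exact lazyLaw_le_sqNorm_half μ k x

/-! ### Summation over time -/

theorem exists_tsum_sum_lazyLaw_le (μ : PMF Γ) {a : ℝ} (ha : 0 < a) {l : ℕ → ℝ}
    (hl : ∀ k : ℕ, 2 ≤ k → 0 < l k ∧ a * k ≤ l k ^ 3 ∧
      ∀ x, lazyLaw μ k x ≤ ENNReal.ofReal (2 * Real.exp (-l k))) :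
    ∃ K B : ℝ≥0, ∀ (F : Finset Γ) (m : ℝ≥0), (F.card : ℝ) ≤ Real.exp m →
      ∑' k, ∑ x ∈ F, lazyLaw μ k x ≤ K * m ^ 3 + B := by
  -- From `exp t ≥ t ^ 6 / 720` at `t = l k / 2`: here `46080 = 64 * 720`, doubled by the prefactor
  -- 2. The sixth power turns `l k ^ 3 ≥ a * k` into `1 / k²`.
  set b : ℕ → ℝ := fun k => 92160 / a ^ 2 * (1 / (k : ℝ) ^ 2) with hb
  have hsum : Summable b := (Real.summable_one_div_nat_pow.2 one_lt_two).mul_left _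
  refine ⟨(8 / a).toNNReal, 3 + (∑' k, ENNReal.ofReal (b k)).toNNReal, fun F m hF => ?_⟩
  -- Past this time `m ≤ l k / 2`, so the cardinality costs only half of the decay.
  set N : ℕ := ⌈8 * (m : ℝ) ^ 3 / a⌉₊ + 2 with hN
  have hm3 : 0 ≤ 8 * (m : ℝ) ^ 3 / a := by positivity
  have hterm : ∀ k, ∑ x ∈ F, lazyLaw μ k x ≤
      (if k ∈ Finset.range N then 1 else 0) + ENNReal.ofReal (b k) := by
    intro k
    by_cases hk : k < N
    · rw [if_pos (Finset.mem_range.2 hk)]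
      exact ((ENNReal.sum_le_tsum F).trans_eq (tsum_lazyLaw μ k)).trans le_self_add
    · rw [if_neg (by simpa using hk), zero_add]
      push Not at hk
      obtain ⟨hlpos, hl3, hx⟩ := hl k (by lia)
      have hk0 : (0 : ℝ) < k := by
        have : 0 < k := by lia
        exact_mod_cast this
      have hml : (m : ℝ) ≤ l k / 2 := by
        have h1 : 8 * (m : ℝ) ^ 3 / a ≤ k := by
          refine (Nat.le_ceil _).trans ?_
          have : ⌈8 * (m : ℝ) ^ 3 / a⌉₊ ≤ k := by lia
          exact_mod_cast this
        rw [div_le_iff₀ ha] at h1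
        have h2 : (2 * (m : ℝ)) ^ 3 ≤ l k ^ 3 := by nlinarith
        have := (pow_le_pow_iff_left₀ (by positivity) hlpos.le three_ne_zero).1 h2
        linarith
      calc ∑ x ∈ F, lazyLaw μ k x ≤ ∑ _x ∈ F, ENNReal.ofReal (2 * Real.exp (-l k)) :=
            Finset.sum_le_sum fun x _ => hx x
        _ = ENNReal.ofReal (F.card * (2 * Real.exp (-l k))) := by
            rw [Finset.sum_const, nsmul_eq_mul, ENNReal.ofReal_mul (Nat.cast_nonneg _),
              ENNReal.ofReal_natCast]
        _ ≤ ENNReal.ofReal (b k) := by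
            refine ENNReal.ofReal_le_ofReal ?_
            have h1 : (F.card : ℝ) ≤ Real.exp (l k / 2) := hF.trans (Real.exp_le_exp.2 hml)
            have h2 := Real.pow_div_factorial_le_exp (l k / 2) (by positivity) 6
            have h3 : (a * k) ^ 2 ≤ (l k ^ 3) ^ 2 := by gcongr
            have h4 : (a * k) ^ 2 / 46080 ≤ Real.exp (l k / 2) := by
              refine le_trans ?_ h2
              rw [show (Nat.factorial 6 : ℝ) = 720 by norm_num [Nat.factorial]]
              have : (l k / 2) ^ 6 / 720 = (l k ^ 3) ^ 2 / 46080 := by ring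
              rw [this]
              gcongr
            calc (F.card : ℝ) * (2 * Real.exp (-l k))
                ≤ Real.exp (l k / 2) * (2 * Real.exp (-l k)) := by gcongr
              _ = 2 * (Real.exp (l k / 2))⁻¹ := by
                rw [← Real.exp_neg, mul_left_comm, ← Real.exp_add]
                ring_nf
              _ ≤ 2 * ((a * k) ^ 2 / 46080)⁻¹ := by gcongr
              _ = b k := by
                rw [hb]
                field_simp
                norm_num
  calc ∑' k, ∑ x ∈ F, lazyLaw μ k x
      ≤ ∑' k, ((if k ∈ Finset.range N then 1 else 0) + ENNReal.ofReal (b k)) :=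
        ENNReal.tsum_le_tsum hterm
    _ = N + ∑' k, ENNReal.ofReal (b k) := by
        rw [ENNReal.tsum_add]
        congr 1
        rw [tsum_eq_sum (s := Finset.range N) (fun k hk => if_neg hk),
          Finset.sum_congr rfl (fun k hk => if_pos hk)]
        simp
    _ ≤ ((8 / a).toNNReal * m ^ 3 + 3 : ℝ≥0) + ∑' k, ENNReal.ofReal (b k) := by
        refine add_le_add_left ?_ _
        have : (N : ℝ≥0) ≤ (8 / a).toNNReal * m ^ 3 + 3 := by
          rw [← NNReal.coe_le_coe]
          push_cast
          rw [Real.coe_toNNReal _ (by positivity), hN]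
          push_cast
          have := (Nat.ceil_lt_add_one hm3).le
          have h8 : 8 / a * (m : ℝ) ^ 3 = 8 * (m : ℝ) ^ 3 / a := by ring
          linarith
        exact_mod_cast this
    _ = _ := by
        rw [ENNReal.coe_add 3, ENNReal.coe_toNNReal hsum.tsum_ofReal_ne_top]
        push_cast
        ring

/-! ### Green functions: comparison and maximum principle -/

open Classical in
theorem sum_transitionProb_succ (μ : PMF Γ) (N : ℕ) (x : Γ) :
    ∑ k ∈ Finset.range (N + 1), transitionProb μ k 1 x =
      (if x = 1 then 1 else 0) +
        markov μ (fun y => ∑ k ∈ Finset.range N, transitionProb μ k 1 y) x := by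
  rw [Finset.sum_range_succ', add_comm]
  congr 1
  simp only [transitionProb, walkLaw_succ_apply, markov, Finset.mul_sum]
  exact (Summable.tsum_finsetSum fun _ _ => ENNReal.summable).symm

theorem green_one_eq (μ : PMF Γ) (x : Γ) : green μ 1 1 x = ∑' k, transitionProb μ k 1 x := by
  simp [green]

theorem green_le_of_forall_sum_le (μ : PMF Γ) (x : Γ) {c : ℝ≥0∞}
    (h : ∀ N, ∑ k ∈ Finset.range N, transitionProb μ k 1 x ≤ c) : green μ 1 1 x ≤ c := by
  rw [green_one_eq, ENNReal.tsum_eq_iSup_nat]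
  exact iSup_le h

/-- The lazy Green function solves `G = δ + G/2 + PG/2`; finiteness permits cancelling `G/2`, so `G
≥ δ + PG`, and iteration dominates the partial sums. -/
theorem green_le_tsum_lazyLaw (μ : PMF Γ) (hfin : ∀ x, ∑' k, lazyLaw μ k x ≠ ∞) (x : Γ) :
    green μ 1 1 x ≤ ∑' k, lazyLaw μ k x := by
  classical
  set G : Γ → ℝ≥0∞ := fun x => ∑' k, lazyLaw μ k x with hG
  have hrec : ∀ x, (if x = 1 then 1 else 0) + markov μ G x ≤ G x := by
    intro x
    have h1 : G x = (if x = 1 then 1 else 0) + (2⁻¹ * G x + 2⁻¹ * markov μ G x) := by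
      rw [hG]
      simp only
      rw [markov_tsum, ← ENNReal.tsum_mul_left, ← ENNReal.tsum_mul_left, ← ENNReal.tsum_add]
      nth_rw 1 [tsum_eq_zero_add' ENNReal.summable]
      rfl
    have h2 : 2⁻¹ * G x + 2⁻¹ * G x =
        2⁻¹ * G x + ((if x = 1 then 1 else 0) + 2⁻¹ * markov μ G x) := by
      rw [half_mul_add_half_mul]
      nth_rw 1 [h1]
      ring
    have h3 := (ENNReal.add_right_inj (ENNReal.mul_ne_top (by simp) (hfin x))).1 h2
    rw [← half_mul_add_half_mul (G x)]
    change 2⁻¹ * G x = _ at h3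
    rw [h3]
    calc (if x = 1 then 1 else 0) + markov μ G x
        = (if x = 1 then 1 else 0) + (2⁻¹ * markov μ G x + 2⁻¹ * markov μ G x) := by
          rw [half_mul_add_half_mul]
      _ ≤ (if x = 1 then 1 else 0) + (2⁻¹ * markov μ G x + 2⁻¹ * markov μ G x)
          + (if x = 1 then 1 else 0) := le_self_add
      _ = _ := by ring
  refine green_le_of_forall_sum_le μ x fun N => ?_
  induction N generalizing x with
  | zero => simp
  | succ N ih =>
    rw [sum_transitionProb_succ]
    exact (add_le_add_right (markov_mono μ ih x) _).trans (hrec x)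

/-- Maximum principle for truncated sums: away from 1, each is an average of shorter ones. -/
theorem green_le_green_one (μ : PMF Γ) (x : Γ) : green μ 1 1 x ≤ green μ 1 1 1 := by
  have h : ∀ N, ∀ x, ∑ k ∈ Finset.range N, transitionProb μ k 1 x ≤
      ∑ k ∈ Finset.range N, transitionProb μ k 1 1 := by
    intro N
    induction N with
    | zero => simp
    | succ N ih =>
      intro x
      by_cases hx : x = 1
      · rw [hx]
      · rw [sum_transitionProb_succ μ N x, if_neg hx, zero_add]
        exact (markov_le_of_le μ ih x).trans
          (Finset.sum_le_sum_of_subset (Finset.range_mono N.le_succ))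
  refine green_le_of_forall_sum_le μ x fun N => (h N x).trans ?_
  rw [green_one_eq]
  exact ENNReal.sum_le_tsum _

theorem tsum_green_eq_top (μ : PMF Γ) : ∑' x, green μ 1 1 x = ∞ := by
  simp_rw [green_one_eq]
  rw [ENNReal.tsum_comm]
  have : ∀ k, ∑' x, transitionProb μ k 1 x = 1 := fun k => (walkLaw μ 1 k).tsum_coe
  simp_rw [this]
  exact ENNReal.tsum_const_eq_top_of_ne_zero one_ne_zero

/-! ### Word balls and growth rates -/

/-- The unit ball of the word metric. -/
noncomputable def unitBall [DecidableEq Γ] (S : Finset Γ) : Finset Γ := insert 1 (S ∪ S⁻¹)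

theorem sphere_subset_unitBall_pow [DecidableEq Γ] {S : Finset Γ}
    (hS : Subgroup.closure (S : Set Γ) = ⊤) (n : ℕ) :
    sphere (S : Set Γ) n ⊆ ((unitBall S ^ n : Finset Γ) : Set Γ) := by
  intro x hx
  -- Since `sInf ∅ = 0`, a word for `x` must be shown to exist.
  have hne : {k : ℕ | ∃ l : List Γ, (∀ g ∈ l, g ∈ (S : Set Γ) ∨ g⁻¹ ∈ (S : Set Γ)) ∧
      l.prod = x ∧ l.length = k}.Nonempty := by
    have hx : x ∈ (Subgroup.closure (S : Set Γ)).toSubmonoid := by rw [hS]; trivial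
    rw [Subgroup.closure_toSubmonoid] at hx
    obtain ⟨l, hl, hp⟩ := Submonoid.exists_list_of_mem_closure hx
    exact ⟨l.length, l, hl, hp, rfl⟩
  obtain ⟨l, hl, hp, hlen⟩ := Nat.sInf_mem hne
  have hlen' : l.length = n := hlen.trans hx
  rw [← hlen', ← hp, Finset.mem_coe]
  clear hlen hlen' hp hne hx
  induction l with
  | nil => simp
  | cons g l ih =>
    rw [List.prod_cons, List.length_cons, pow_succ']
    refine Finset.mul_mem_mul ?_ (ih fun h hh => hl h (List.mem_cons_of_mem _ hh))
    have := hl g List.mem_cons_self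
    simp only [Finset.mem_coe] at this
    simp [unitBall, this]

theorem log_div_lt_iff {a : ℝ≥0∞} {n : ℕ} (hn : 1 ≤ n) (c : ℝ) :
    ENNReal.log a / (n : EReal) < c ↔ a < ENNReal.ofReal (Real.exp (c * n)) := by
  have h0 : (0 : EReal) < n := by exact_mod_cast hn
  rw [EReal.div_lt_iff h0 (EReal.natCast_ne_top n)]
  have : (c : EReal) * (n : EReal) = ((c * n : ℝ) : EReal) := by push_cast; rfl
  rw [this, ← EReal.exp_coe, ← ENNReal.log_lt_log_iff, EReal.log_exp]

theorem eventually_lt_of_growthRate_lt {a : ℕ → ℝ≥0∞} {c : ℝ} (h : growthRate a < c) :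
    ∀ᶠ n : ℕ in atTop, a n < ENNReal.ofReal (Real.exp (c * n)) := by
  filter_upwards [eventually_lt_of_limsup_lt h, eventually_ge_atTop 1] with n hn h1
  exact (log_div_lt_iff h1 c).1 hn

theorem growthRate_le_zero {a : ℕ → ℝ≥0∞}
    (h : ∀ c : ℝ, 0 < c → ∀ᶠ n : ℕ in atTop, a n < ENNReal.ofReal (Real.exp (c * n))) :
    growthRate a ≤ 0 := by
  refine EReal.le_of_forall_lt_iff_le.1 fun c hc => limsup_le_of_le (by isBoundedDefault) ?_
  filter_upwards [h c (by exact_mod_cast hc), eventually_ge_atTop 1] with n hn h1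
  exact ((log_div_lt_iff h1 c).2 hn).le

theorem eventually_const_mul_cube_lt_exp {c : ℝ} (hc : 0 < c) (C : ℝ≥0) :
    ∀ᶠ n : ℕ in atTop, (C : ℝ≥0∞) * (n : ℝ≥0∞) ^ 3 < ENNReal.ofReal (Real.exp (c * n)) := by
  have hC : (0 : ℝ) < 1 / (C + 1) := by positivity
  have := tendsto_natCast_atTop_atTop (R := ℝ) |>.eventually
    ((isLittleO_pow_exp_pos_mul_atTop 3 hc).bound hC)
  filter_upwards [this, eventually_ge_atTop 1] with n hn h1
  rw [Real.norm_of_nonneg (by positivity), Real.norm_of_nonneg (by positivity),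
    one_div, inv_mul_eq_div, le_div_iff₀ (by positivity)] at hn
  have hn1 : (0 : ℝ) < (n : ℝ) ^ 3 := by
    have : (0 : ℝ) < n := by exact_mod_cast h1
    positivity
  have h2 : (C : ℝ≥0∞) * (n : ℝ≥0∞) ^ 3 = ENNReal.ofReal (C * (n : ℝ) ^ 3) := by
    rw [ENNReal.ofReal_mul (by positivity), ENNReal.ofReal_coe_nnreal,
      ENNReal.ofReal_pow (by positivity), ENNReal.ofReal_natCast]
  rw [h2, ENNReal.ofReal_lt_ofReal_iff (by positivity)]
  nlinarith

/-- Submultiplicativity upgrades the limsup to every radius: take a large sphere of radius `n ≥ r`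
and cover it by `⌊n/r⌋ + 1` factors. Rounding up halves the rate. -/
theorem exists_exp_le_card_pow [DecidableEq Γ] {S : Finset Γ}
    (hS : Subgroup.closure (S : Set Γ) = ⊤) (h : HasExponentialGrowth (S : Set Γ)) :
    ∃ c > 0, ∀ r : ℕ, Real.exp (c * r) ≤ (unitBall S ^ r).card := by
  obtain ⟨c, hc0, hc⟩ := EReal.lt_iff_exists_real_btwn.1 h
  have hc0 : 0 < c := by exact_mod_cast hc0
  have hfreq := frequently_lt_of_lt_limsup (by isBoundedDefault) hc
  refine ⟨c / 2, by positivity, fun r => ?_⟩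
  rcases Nat.eq_zero_or_pos r with rfl | hr
  · simp
  obtain ⟨n, hn, hnr⟩ := (hfreq.and_eventually (eventually_ge_atTop r)).exists
  have h1 : ENNReal.ofReal (Real.exp (c * n)) ≤ ((sphere (S : Set Γ) n).encard : ℝ≥0∞) :=
    not_lt.1 fun hlt => hn.not_gt ((log_div_lt_iff (hr.trans_le hnr) c).2 hlt)
  have hone : (1 : Γ) ∈ unitBall S := Finset.mem_insert_self _ _
  have h2 : Real.exp (c * n) ≤ (unitBall S ^ n).card := by
    have h3 := Set.encard_le_encard (sphere_subset_unitBall_pow hS n)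
    rw [Set.encard_coe_eq_coe_finsetCard] at h3
    have h4 := h1.trans (ENat.toENNReal_le.2 h3)
    rw [ENat.toENNReal_coe, ← ENNReal.ofReal_natCast,
      ENNReal.ofReal_le_ofReal_iff (by positivity)] at h4
    exact h4
  have h3 : (unitBall S ^ n).card ≤ (unitBall S ^ r).card ^ (n / r + 1) := by
    refine le_trans (Finset.card_le_card ?_) Finset.card_pow_le
    rw [← pow_mul]
    refine Finset.pow_subset_pow_right hone ?_
    have := Nat.div_add_mod n r
    have := Nat.mod_lt n hr
    lia
  have hpos : (0 : ℝ) < (unitBall S ^ r).card := by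
    have : (unitBall S ^ r).Nonempty := ⟨1, Finset.one_mem_pow hone⟩
    exact_mod_cast this.card_pos
  set L := Real.log (unitBall S ^ r).card with hL
  have hL0 : 0 ≤ L := Real.log_natCast_nonneg _
  have h4 : c * n ≤ ((n / r : ℕ) + 1 : ℝ) * L := by
    have h5 : Real.exp (c * n) ≤ ((unitBall S ^ r).card : ℝ) ^ (n / r + 1) :=
      h2.trans (by exact_mod_cast h3)
    have h6 := Real.log_le_log (Real.exp_pos _) h5
    rw [Real.log_exp, Real.log_pow] at h6
    push_cast at h6
    exact h6
  rw [← Real.le_log_iff_exp_le hpos, ← hL]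
  have hr' : (0 : ℝ) < r := by exact_mod_cast hr
  have hn' : (0 : ℝ) < n := by exact_mod_cast hr.trans_le hnr
  have h5 : ((n / r : ℕ) + 1 : ℝ) * r ≤ 2 * n := by
    have : (n / r + 1) * r ≤ 2 * n := by
      have := Nat.div_mul_le_self n r
      nlinarith
    exact_mod_cast this
  have h6 : c * n * r ≤ 2 * n * L := by
    calc c * n * r ≤ ((n / r : ℕ) + 1 : ℝ) * L * r := by gcongr
      _ = ((n / r : ℕ) + 1 : ℝ) * r * L := by ring
      _ ≤ 2 * n * L := by gcongr
  have h7 : n * (c / 2 * r) ≤ n * L := by linarith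
  exact le_of_mul_le_mul_left h7 hn'

/-! ### The cubic bound and the growth rate -/

theorem greenSphere_le_sum [DecidableEq Γ] {S : Finset Γ}
    (hS : Subgroup.closure (S : Set Γ) = ⊤) (μ : PMF Γ) (n : ℕ) :
    greenSphere (S : Set Γ) μ 1 n ≤ ∑ x ∈ unitBall S ^ n, green μ 1 1 x := by
  rw [← Finset.tsum_subtype']
  exact ENNReal.tsum_mono_subtype _ (sphere_subset_unitBall_pow hS n)

theorem greenSphere_cubic_bound {S : Finset Γ} (hS : Subgroup.closure (S : Set Γ) = ⊤)
    (μ : PMF Γ) (hμ : IsAdmissible μ) (h : HasExponentialGrowth (S : Set Γ)) :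
    ∃ C : ℝ≥0, 0 < C ∧ ∀ n : ℕ, 1 ≤ n →
      greenSphere (S : Set Γ) μ 1 n ≤ (C : ℝ≥0∞) * (n : ℝ≥0∞) ^ 3 := by
  classical
  obtain ⟨c, hc, hT⟩ := exists_exp_le_card_pow hS h
  obtain ⟨a, ha, l, hl⟩ := exists_lazyLaw_decay μ hμ hc hT
  obtain ⟨K, B, hKB⟩ := exists_tsum_sum_lazyLaw_le μ ha hl
  have hfin : ∀ x, ∑' k, lazyLaw μ k x ≠ ∞ := fun x => by
    have := hKB {x} 0 (by simp)
    simp only [Finset.sum_singleton] at this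
    exact (this.trans_lt (by simp)).ne
  have hone : (1 : Γ) ∈ unitBall S := Finset.mem_insert_self _ _
  -- The ball of radius `n` has at most `exp (n * d)` elements, so `m = n * d` yields the cube of
  -- `n`.
  set d : ℝ≥0 := (Real.log (unitBall S).card).toNNReal with hd
  have hd' : (d : ℝ) = Real.log (unitBall S).card :=
    Real.coe_toNNReal _ (Real.log_natCast_nonneg _)
  refine ⟨K * d ^ 3 + B + 1, by positivity, fun n hn => ?_⟩
  have hcard : ((unitBall S ^ n).card : ℝ) ≤ Real.exp ((n * d : ℝ≥0) : ℝ) := by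
    have h1 : (0 : ℝ) < (unitBall S).card := by exact_mod_cast Finset.card_pos.2 ⟨1, hone⟩
    push_cast
    rw [hd', Real.exp_nat_mul, Real.exp_log h1]
    exact_mod_cast Finset.card_pow_le
  have h1 : (1 : ℝ≥0∞) ≤ (n : ℝ≥0∞) ^ 3 := one_le_pow₀ (by exact_mod_cast hn)
  calc greenSphere (S : Set Γ) μ 1 n ≤ ∑ x ∈ unitBall S ^ n, green μ 1 1 x :=
        greenSphere_le_sum hS μ n
    _ ≤ ∑ x ∈ unitBall S ^ n, ∑' k, lazyLaw μ k x :=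
        Finset.sum_le_sum fun x _ => green_le_tsum_lazyLaw μ hfin x
    _ = ∑' k, ∑ x ∈ unitBall S ^ n, lazyLaw μ k x :=
        (Summable.tsum_finsetSum fun _ _ => ENNReal.summable).symm
    _ ≤ K * ((n * d : ℝ≥0) : ℝ≥0∞) ^ 3 + B := hKB _ _ hcard
    _ ≤ K * ((n * d : ℝ≥0) : ℝ≥0∞) ^ 3 + (B + 1) * (n : ℝ≥0∞) ^ 3 := by
        refine add_le_add_right ?_ _
        calc (B : ℝ≥0∞) ≤ (B + 1) * 1 := by rw [mul_one]; exact le_self_add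
          _ ≤ _ := mul_le_mul_right h1 _
    _ = _ := by push_cast; ring

theorem tsum_greenSphere (S : Set Γ) (μ : PMF Γ) :
    ∑' n, greenSphere S μ 1 n = ∑' x, green μ 1 1 x := by
  rw [← (Equiv.sigmaFiberEquiv (wordLength S)).tsum_eq, ENNReal.tsum_sigma']
  rfl

/-- A negative rate would make `∑ H_1(n)` converge, each term being finite by transience. -/
theorem omega_nonneg {S : Finset Γ} (hS : Subgroup.closure (S : Set Γ) = ⊤) {μ : PMF Γ}
    (h : IsTransient μ) : 0 ≤ omega (S : Set Γ) μ 1 := by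
  classical
  by_contra! hlt
  obtain ⟨c, hc, hc0⟩ := EReal.lt_iff_exists_real_btwn.1 hlt
  have hc0 : c < 0 := by exact_mod_cast hc0
  obtain ⟨N, hN⟩ := eventually_atTop.1 (eventually_lt_of_growthRate_lt hc)
  set H := greenSphere (S : Set Γ) μ 1
  have hH : ∀ n, H n ≠ ∞ := fun n => by
    refine ((greenSphere_le_sum hS μ n).trans_lt (ENNReal.sum_lt_top.2 fun x _ => ?_)).ne
    exact (green_le_green_one μ x).trans_lt h
  have hsum : Summable fun n : ℕ => Real.exp (c * n) := by
    simpa only [mul_comm] using Real.summable_exp_nat_mul_iff.2 hc0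
  have hle : ∀ n, H n ≤ (if n ∈ Finset.range N then H n else 0)
      + ENNReal.ofReal (Real.exp (c * n)) := by
    intro n
    by_cases hn : n < N
    · rw [if_pos (Finset.mem_range.2 hn)]
      exact le_self_add
    · rw [if_neg (by simpa using hn), zero_add]
      exact (hN n (not_lt.1 hn)).le
  have hlt_top : ∑' n, H n < ∞ := by
    refine (ENNReal.tsum_le_tsum hle).trans_lt ?_
    rw [ENNReal.tsum_add, tsum_eq_sum (s := Finset.range N) (fun k hk => if_neg hk)]
    refine ENNReal.add_lt_top.2 ⟨ENNReal.sum_lt_top.2 fun n _ => ?_, hsum.tsum_ofReal_lt_top⟩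
    split_ifs
    exact (hH n).lt_top
  exact hlt_top.ne ((tsum_greenSphere (S : Set Γ) μ).trans (tsum_green_eq_top μ))

theorem omega_nonpos {S : Finset Γ} (hS : Subgroup.closure (S : Set Γ) = ⊤) {μ : PMF Γ}
    (hμ : IsAdmissible μ) (h : IsTransient μ) : omega (S : Set Γ) μ 1 ≤ 0 := by
  classical
  refine growthRate_le_zero fun c hc => ?_
  by_cases hexp : HasExponentialGrowth (S : Set Γ)
  · obtain ⟨C, -, hC⟩ := greenSphere_cubic_bound hS μ hμ hexp
    filter_upwards [eventually_const_mul_cube_lt_exp hc C, eventually_ge_atTop 1] with n hn h1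
    exact (hC n h1).trans_lt hn
  · have hv : volumeGrowth (S : Set Γ) < ((c / 2 : ℝ) : EReal) :=
      (not_lt.1 hexp).trans_lt (by exact_mod_cast half_pos hc)
    filter_upwards [eventually_lt_of_growthRate_lt hv,
      eventually_const_mul_cube_lt_exp (half_pos hc) (green μ 1 1 1).toNNReal,
      eventually_ge_atTop 1] with n hn hG h1
    rw [ENNReal.coe_toNNReal h.ne] at hG
    calc greenSphere (S : Set Γ) μ 1 n ≤ ∑' _x : sphere (S : Set Γ) n, green μ 1 1 1 :=
          ENNReal.tsum_le_tsum fun x => green_le_green_one μ x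
      _ = ((sphere (S : Set Γ) n).encard : ℝ≥0∞) * green μ 1 1 1 := by
          rw [ENNReal.tsum_const]
          rfl
      -- The factor `n³ ≥ 1` is inserted to reuse the comparison of cubes with exponentials.
      _ ≤ ((sphere (S : Set Γ) n).encard : ℝ≥0∞) * (green μ 1 1 1 * (n : ℝ≥0∞) ^ 3) :=
          mul_le_mul_right (le_mul_of_one_le_right' (one_le_pow₀ (by exact_mod_cast h1))) _
      _ < ENNReal.ofReal (Real.exp (c / 2 * n)) * ENNReal.ofReal (Real.exp (c / 2 * n)) :=
          ENNReal.mul_lt_mul hn hG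
      _ = ENNReal.ofReal (Real.exp (c * n)) := by
          rw [← ENNReal.ofReal_mul (by positivity), ← Real.exp_add]
          ring_nf

end GreenGrowth

theorem mainTheorem9 {Γ : Type*} [Group Γ] (S : Finset Γ)
    (hS : Subgroup.closure (S : Set Γ) = ⊤) (μ : PMF Γ) (hμ : GreenGrowth.IsAdmissible μ) :
    (GreenGrowth.IsTransient μ → GreenGrowth.omega (S : Set Γ) μ 1 = 0) ∧
      (GreenGrowth.HasExponentialGrowth (S : Set Γ) →
        ∃ C : ℝ≥0, 0 < C ∧ ∀ n : ℕ, 1 ≤ n →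
          GreenGrowth.greenSphere (S : Set Γ) μ 1 n ≤ (C : ℝ≥0∞) * (n : ℝ≥0∞) ^ 3) :=
  ⟨fun h => le_antisymm (GreenGrowth.omega_nonpos hS hμ h) (GreenGrowth.omega_nonneg hS h),
    GreenGrowth.greenSphere_cubic_bound hS μ hμ⟩
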